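/- For $\rho\in\mathbb{R}$ let $$f_\rho(x,y,z)=x^2\bigl(\rho^2x^2+\rho y^2-\tfrac12 z^2\bigr)^2+y^2\bigl(\rho^2y^2+\rho z^2-\tfrac12 x^2\bigr)^2+z^2\bigl(\rho^2z^2+\rho x^2-\tfrac12 y^2\bigr)^2\in\mathbb{R}[x,y,z].$$ A form $f\in\mathbb{R}[x_1,\dots,x_n]$ is positive definite if $f(a)>0$ for all $a\in\mathbb{R}^n\setminus\{0\}$. A Gram matrix of a ternary sextic $f$ is a real symmetric positive semidefinite $10\times10$ matrix $G=(G_{\alpha\beta})$, indexed by the multi-indices $\alpha,\beta\in\mathbb{N}_0^3$ of order $3$, such that $f=\sum_{\alpha,\beta}G_{\alpha\beta}\,\mathbf{x}^{\alpha+\beta}$. A polynomial $f\in\mathbb{R}[x_1,\dots,x_n]$ is a coercive sum of squares if $f=\sum_{j=1}^r p_j^2$ for some $p_1,\dots,p_r\in\mathbb{R}[x_1,\dots,x_n]$ that have no common zero in $\mathbb{C}^n\setminus\{0\}$. Theorem. Let $\rho\in\mathbb{R}$. (1) The form $f_\rho$ is positive definite and has a unique Gram matrix if and only if $$-\frac{5+3\sqrt3}{4}<\rho^3<-\frac12\quad\text{or}\quad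 0<\rho^3<\frac{-5+3\sqrt3}{4}.$$ (2) If $f_\rho$ is positive definite and $\rho^3$ lies in neither of these two open intervals, then $f_\rho$ has a Gram matrix of rank $10$. (3) If $\rho^3\notin\left\{-\frac{5+3\sqrt3}{4},\,-\frac12,\,0,\,\frac{-5+3\sqrt3}{4}\right\}$, then $f_\rho$ is a coercive sum of squares. -/

import Mathlib

namespace GramForms

open MvPolynomial

/-- A real polynomial in `n` variables is positive definite (`pd`) when it is strictly positive at
every nonzero point of `ℝⁿ`. -/
def IsPD {n : ℕ} (f : MvPolynomial (Fin n) ℝ) : Prop :=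
  ∀ x : Fin n → ℝ, x ≠ 0 → 0 < eval x f

/-- A polynomial is a coercive sum of squares when it has a representation `f = ∑ⱼ pⱼ²` with real
polynomials `p₁, …, pᵣ` that have no common zero in `ℂⁿ ∖ {0}`. -/
def IsCoercive {n : ℕ} (f : MvPolynomial (Fin n) ℝ) : Prop :=
  ∃ (r : ℕ) (p : Fin r → MvPolynomial (Fin n) ℝ),
    f = ∑ j, p j ^ 2 ∧ ¬ ∃ a : Fin n → ℂ, a ≠ 0 ∧ ∀ j, aeval a (p j) = 0

/-- The multi-indices `α ∈ ℕⁿ` of order `|α| = p`. -/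
def MultiIndex (n p : ℕ) : Type := {α : Fin n → ℕ // ∑ i, α i = p}

instance (n p : ℕ) : DecidableEq (MultiIndex n p) :=
  inferInstanceAs (DecidableEq {α : Fin n → ℕ // ∑ i, α i = p})

instance (n p : ℕ) : Fintype (MultiIndex n p) :=
  Fintype.subtype (Finset.Nat.antidiagonalTuple n p)
    (fun _ => Finset.Nat.mem_antidiagonalTuple)

/-- The monomial `x^α = x₁^α₁ ⋯ xₙ^αₙ`. -/
noncomputable def mono {n p : ℕ} (α : MultiIndex n p) : MvPolynomial (Fin n) ℝ :=
  ∏ i, X i ^ α.1 i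

/-- The form of degree `2p` that is represented by the matrix `G`, whose rows and columns are
indexed by the multi-indices of order `p`: it is `∑_{α, β} G_{α β} x^(α + β)`. -/
noncomputable def formOf {n p : ℕ} (G : Matrix (MultiIndex n p) (MultiIndex n p) ℝ) :
    MvPolynomial (Fin n) ℝ :=
  ∑ α, ∑ β, C (G α β) * (mono α * mono β)

/-- `G` is a Gram matrix for the form `f`: a (symmetric) positive semidefinite matrix that
represents `f`. -/
def IsGramMatrix {n p : ℕ} (G : Matrix (MultiIndex n p) (MultiIndex n p) ℝ)
    (f : MvPolynomial (Fin n) ℝ) : Prop :=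
  G.PosSemidef ∧ f = formOf G

/-- The ternary sextic `f_ρ`, in the variables `x = X 0`, `y = X 1`, `z = X 2`. -/
noncomputable def sextic (ρ : ℝ) : MvPolynomial (Fin 3) ℝ :=
  X 0 ^ 2 * (C (ρ ^ 2) * X 0 ^ 2 + C ρ * X 1 ^ 2 - C (1 / 2) * X 2 ^ 2) ^ 2
    + X 1 ^ 2 * (C (ρ ^ 2) * X 1 ^ 2 + C ρ * X 2 ^ 2 - C (1 / 2) * X 0 ^ 2) ^ 2
    + X 2 ^ 2 * (C (ρ ^ 2) * X 2 ^ 2 + C ρ * X 0 ^ 2 - C (1 / 2) * X 1 ^ 2) ^ 2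

/-- The condition `-(5 + 3√3)/4 < ρ³ < -1/2` or `0 < ρ³ < (-5 + 3√3)/4`. -/
def InIntervals (ρ : ℝ) : Prop :=
  (-((5 + 3 * √3) / 4) < ρ ^ 3 ∧ ρ ^ 3 < -(1 / 2)) ∨ (0 < ρ ^ 3 ∧ ρ ^ 3 < (-5 + 3 * √3) / 4)

end GramForms

/-! Write `sextic ρ = ∑ pᵢ²` with `pᵢ = xᵢ (ρ² xᵢ² + ρ xᵢ₊₁² - xᵢ₊₂² / 2)`. Away from the
exceptional values of `ρ³` the `pᵢ` have no common zero but the origin, even over `ℂ`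
(`eq_zero_of_common_zero`); this gives coercivity and positive definiteness.

Gram matrices are governed by one linear functional `L` on sextics: it is cyclic, vanishes on
monomials with an odd exponent, and kills `pᵢ q` for every cubic `q`. Its values on `x⁶, x⁴y², x⁴z²,
x²y²z²` are `a = 1/8 - 2ρ³`, `b = 3ρ⁴/2`, `c = ρ²(1/4 - ρ³)`, `d = ρ³(ρ³ + 1/2)`. The two intervals
are exactly where `d > 0` and `bc - d² > 0` (`inIntervals_iff`).

Inside them `L` is nonnegative on squares of cubics and vanishes only on squares from the span of
the `pᵢ`. Since `L (sextic ρ) = 0`, any Gram matrix is built from the `pᵢ`, and independence of the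
products `pᵢ pⱼ` determines it (`eq_of_isGramMatrix_sextic`).

Outside them, if the form is positive definite, `L` is negative on some square. Adding squares to
the sum of all squared monomials then yields a form `g` with `L g = 0`, which forces `g = ∑ pᵢ hᵢ`
(`exists_multiplier`). Perturbing `pᵢ` along `hᵢ` makes a positive definite Gram matrix
(`exists_posDef_formOf`). Its rank is 10, while that of `∑ pᵢ pᵢᵀ` is at most 3, so uniqueness
fails. -/

namespace GramForms

open MvPolynomial Matrix

/-! ### Gram matrices and sums of squares in general -/

section General

variable {n d : ℕ}

/-- The form of degree `d` with a given vector of coefficients. -/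
noncomputable def toForm : (MultiIndex n d → ℝ) →ₗ[ℝ] MvPolynomial (Fin n) ℝ :=
  Fintype.linearCombination ℝ mono

lemma toForm_apply (v : MultiIndex n d → ℝ) : toForm v = ∑ α, C (v α) * mono α := by
  simp [toForm, Fintype.linearCombination_apply, smul_eq_C_mul]

lemma toForm_single (α : MultiIndex n d) : toForm (Pi.single α 1) = mono α := by
  simp [toForm]

lemma formOf_vecMulVec (v w : MultiIndex n d → ℝ) :
    formOf (vecMulVec v w) = toForm v * toForm w := by
  simp only [formOf, toForm_apply, Finset.sum_mul_sum, vecMulVec_apply, map_mul]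
  exact Finset.sum_congr rfl fun _ _ => Finset.sum_congr rfl fun _ _ => by ring

lemma formOf_add (G H : Matrix (MultiIndex n d) (MultiIndex n d) ℝ) :
    formOf (G + H) = formOf G + formOf H := by
  simp [formOf, add_mul, Finset.sum_add_distrib]

lemma formOf_smul (c : ℝ) (G : Matrix (MultiIndex n d) (MultiIndex n d) ℝ) :
    formOf (c • G) = C c * formOf G := by
  simp [formOf, Finset.mul_sum, mul_assoc]

lemma formOf_sum {ι : Type*} (s : Finset ι)
    (G : ι → Matrix (MultiIndex n d) (MultiIndex n d) ℝ) :
    formOf (∑ i ∈ s, G i) = ∑ i ∈ s, formOf (G i) := by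
  classical
  induction s using Finset.induction_on with
  | empty => simp [formOf]
  | insert i s hi ih => rw [Finset.sum_insert hi, Finset.sum_insert hi, formOf_add, ih]

lemma formOf_one :
    formOf (1 : Matrix (MultiIndex n d) (MultiIndex n d) ℝ) = ∑ α : MultiIndex n d, mono α ^ 2 := by
  refine Finset.sum_congr rfl fun α _ => ?_
  rw [Finset.sum_eq_single α]
  · simp [sq]
  · intro β _ h
    simp [Matrix.one_apply_ne h.symm]
  · simp

lemma formOf_sum_vecMulVec {ι : Type*} [Fintype ι] (p : ι → MultiIndex n d → ℝ) :
    formOf (∑ i, vecMulVec (p i) (p i)) = ∑ i, toForm (p i) ^ 2 := by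
  simp [formOf_sum, formOf_vecMulVec, sq]

lemma posSemidef_vecMulVec_real {m : Type*} [Fintype m] (v : m → ℝ) :
    (vecMulVec v v).PosSemidef := by
  simpa using posSemidef_vecMulVec_self_star v

lemma posSemidef_sum_vecMulVec {m ι : Type*} [Fintype m] [Fintype ι] (p : ι → m → ℝ) :
    (∑ i, vecMulVec (p i) (p i)).PosSemidef :=
  posSemidef_sum _ fun i _ => posSemidef_vecMulVec_real (p i)

lemma isGramMatrix_sum_vecMulVec {ι : Type*} [Fintype ι] (p : ι → MultiIndex n d → ℝ) :
    IsGramMatrix (∑ i, vecMulVec (p i) (p i)) (∑ i, toForm (p i) ^ 2) :=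
  ⟨posSemidef_sum_vecMulVec p, (formOf_sum_vecMulVec p).symm⟩

lemma rank_sum_vecMulVec_le {m ι : Type*} [Fintype m] [Fintype ι] (p : ι → m → ℝ) :
    (∑ i, vecMulVec (p i) (p i)).rank ≤ Fintype.card ι := by
  have h : ∑ i, vecMulVec (p i) (p i) = (of p)ᵀ * of p := by
    ext α β
    simp [Matrix.sum_apply, vecMulVec_apply, Matrix.mul_apply]
  rw [h]
  exact (rank_mul_le_right _ _).trans (rank_le_card_height _)

/-- A small multiple of a sum of rank-one matrices leaves the identity positive definite. -/
lemma exists_posDef_one_sub_smul {m ι : Type*} [Fintype m] [DecidableEq m] [Fintype ι]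
    (h : ι → m → ℝ) :
    ∃ ε : ℝ, 0 < ε ∧ (1 - ε • ∑ i, vecMulVec (h i) (h i)).PosDef := by
  set N : ℝ := ∑ i, h i ⬝ᵥ h i
  have hN : 0 ≤ N := Finset.sum_nonneg fun i _ => Finset.sum_nonneg fun a _ => mul_self_nonneg _
  refine ⟨1 / (N + 1), by positivity, ?_⟩
  refine PosDef.of_dotProduct_mulVec_pos ?_ fun x hx => ?_
  · refine isHermitian_one.sub ?_
    exact ((posSemidef_sum_vecMulVec h).smul (by positivity : (0 : ℝ) ≤ 1 / (N + 1))).1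
  · have hxx : 0 < x ⬝ᵥ x := by
      have := dotProduct_star_self_pos_iff.2 hx
      simpa using this
    -- Cauchy–Schwarz; the `+ 1` in `1 / (N + 1)` makes the final inequality strict.
    have hle : ∑ i, (h i ⬝ᵥ x) ^ 2 ≤ N * (x ⬝ᵥ x) := by
      rw [Finset.sum_mul]
      refine Finset.sum_le_sum fun i _ => ?_
      have := Finset.sum_mul_sq_le_sq_mul_sq Finset.univ (h i) x
      simpa [dotProduct, sq] using this
    have hq : star x ⬝ᵥ ((1 - (1 / (N + 1)) • ∑ i, vecMulVec (h i) (h i)) *ᵥ x)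
        = x ⬝ᵥ x - (1 / (N + 1)) * ∑ i, (h i ⬝ᵥ x) ^ 2 := by
      simp only [star_trivial, sub_mulVec, one_mulVec, smul_mulVec, sum_mulVec, vecMulVec_mulVec,
        dotProduct_sub, dotProduct_smul, dotProduct_sum, smul_eq_mul]
      congr 2
      refine Finset.sum_congr rfl fun i _ => ?_
      simp [dotProduct_comm x (h i), sq]
    rw [hq, sub_pos, one_div, inv_mul_lt_iff₀ (by positivity)]
    nlinarith

/-- If a form with a positive definite Gram matrix lies in the ideal of the `pᵢ`, then `∑ pᵢ²` has
a positive definite Gram matrix. -/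
theorem exists_posDef_formOf {ι : Type*} [Fintype ι] (p h : ι → MultiIndex n d → ℝ)
    {S : Matrix (MultiIndex n d) (MultiIndex n d) ℝ} (hS : S.PosSemidef)
    (hg : formOf (1 + S) = ∑ i, toForm (p i) * toForm (h i)) :
    ∃ G : Matrix (MultiIndex n d) (MultiIndex n d) ℝ,
      G.PosDef ∧ ∑ i, toForm (p i) ^ 2 = formOf G := by
  obtain ⟨ε, hε, hpd⟩ := exists_posDef_one_sub_smul h
  -- With `g = ∑ pᵢ hᵢ`, this is the identity `∑ pᵢ² = 4ε (g - ε ∑ hᵢ²) + ∑ (pᵢ - 2ε hᵢ)²`.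
  refine ⟨(4 * ε) • ((1 - ε • ∑ i, vecMulVec (h i) (h i)) + S) +
    ∑ i, vecMulVec (p i - (2 * ε) • h i) (p i - (2 * ε) • h i), ?_, ?_⟩
  · exact ((hpd.add_posSemidef hS).smul (by positivity)).add_posSemidef
      (posSemidef_sum_vecMulVec _)
  · have e : (1 - ε • ∑ i, vecMulVec (h i) (h i)) + S
        = (1 + S) + (-ε) • ∑ i, vecMulVec (h i) (h i) := by
      rw [neg_smul]; abel
    rw [e, formOf_add, formOf_smul, formOf_add, hg, formOf_smul, formOf_sum_vecMulVec,
      formOf_sum_vecMulVec, Finset.mul_sum, ← Finset.sum_add_distrib, Finset.mul_sum,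
      ← Finset.sum_add_distrib]
    refine Finset.sum_congr rfl fun i _ => ?_
    simp only [map_sub, map_smul, smul_eq_C_mul, map_neg, map_mul, map_ofNat]
    ring

end General

/-! ### Ternary cubics and the three cubics of the sextic -/

/-- The multi-index `(i, j, k)` of order three. -/
def cubicIndex (i j k : ℕ) (h : i + j + k = 3) : MultiIndex 3 3 :=
  ⟨![i, j, k], by simp [Fin.sum_univ_three, h]⟩

lemma univ_multiIndex_three_three : (Finset.univ : Finset (MultiIndex 3 3)) =
    {cubicIndex 3 0 0 rfl, cubicIndex 0 3 0 rfl, cubicIndex 0 0 3 rfl,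
      cubicIndex 1 2 0 rfl, cubicIndex 0 1 2 rfl, cubicIndex 2 0 1 rfl,
      cubicIndex 1 0 2 rfl, cubicIndex 2 1 0 rfl, cubicIndex 0 2 1 rfl, cubicIndex 1 1 1 rfl} := by
  decide

lemma card_multiIndex_three_three : Fintype.card (MultiIndex 3 3) = 10 := by
  rw [← Finset.card_univ, univ_multiIndex_three_three]
  decide

lemma sum_multiIndex_three_three {M : Type*} [AddCommMonoid M] (F : MultiIndex 3 3 → M) :
    ∑ α, F α = F (cubicIndex 3 0 0 rfl) + (F (cubicIndex 0 3 0 rfl) + (F (cubicIndex 0 0 3 rfl) +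
      (F (cubicIndex 1 2 0 rfl) + (F (cubicIndex 0 1 2 rfl) + (F (cubicIndex 2 0 1 rfl) +
      (F (cubicIndex 1 0 2 rfl) + (F (cubicIndex 2 1 0 rfl) + (F (cubicIndex 0 2 1 rfl) +
      F (cubicIndex 1 1 1 rfl))))))))) := by
  rw [univ_multiIndex_three_three]
  repeat rw [Finset.sum_insert (by decide)]
  rw [Finset.sum_singleton]

lemma forall_multiIndex_three_three {P : MultiIndex 3 3 → Prop} : (∀ α, P α) ↔
    P (cubicIndex 3 0 0 rfl) ∧ P (cubicIndex 0 3 0 rfl) ∧ P (cubicIndex 0 0 3 rfl) ∧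
      P (cubicIndex 1 2 0 rfl) ∧ P (cubicIndex 0 1 2 rfl) ∧ P (cubicIndex 2 0 1 rfl) ∧
      P (cubicIndex 1 0 2 rfl) ∧ P (cubicIndex 2 1 0 rfl) ∧ P (cubicIndex 0 2 1 rfl) ∧
      P (cubicIndex 1 1 1 rfl) := by
  have h : (∀ α, P α) ↔ ∀ α ∈ (Finset.univ : Finset (MultiIndex 3 3)), P α := by simp
  rw [h, univ_multiIndex_three_three]
  simp only [Finset.forall_mem_insert, Finset.mem_singleton, forall_eq]

/-- The coefficient vector of the cubic `xᵢ (u xᵢ² + v xᵢ₊₁² + w xᵢ₊₂²)`. -/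
noncomputable def blockVec (i : Fin 3) (u v w : ℝ) : MultiIndex 3 3 → ℝ := fun α =>
  if α.1 i = 3 then u else if α.1 i = 1 ∧ α.1 (i + 1) = 2 then v
    else if α.1 i = 1 ∧ α.1 (i + 2) = 2 then w else 0

lemma toForm_blockVec (i : Fin 3) (u v w : ℝ) : toForm (blockVec i u v w) =
    X i * (C u * X i ^ 2 + C v * X (i + 1) ^ 2 + C w * X (i + 2) ^ 2) := by
  rw [toForm_apply, sum_multiIndex_three_three]
  fin_cases i <;> simp [blockVec, cubicIndex, mono, Fin.prod_univ_three] <;> ring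

/-- The coefficient vector of the `i`-th cubic in the definition of `sextic ρ`. -/
noncomputable def cubicVec (ρ : ℝ) (i : Fin 3) : MultiIndex 3 3 → ℝ :=
  blockVec i (ρ ^ 2) ρ (-(1 / 2))

lemma sextic_eq_sum (ρ : ℝ) : sextic ρ = ∑ i, toForm (cubicVec ρ i) ^ 2 := by
  simp [Fin.sum_univ_three, cubicVec, toForm_blockVec, sextic]
  ring

lemma isGramMatrix_sextic (ρ : ℝ) :
    IsGramMatrix (∑ i, vecMulVec (cubicVec ρ i) (cubicVec ρ i)) (sextic ρ) :=
  sextic_eq_sum ρ ▸ isGramMatrix_sum_vecMulVec (cubicVec ρ)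

/-! ### Common zeros -/

lemma circulant_factor (ρ : ℝ) : (ρ ^ 3) ^ 2 + 5 / 2 * ρ ^ 3 - 1 / 8 =
    (ρ ^ 3 - -((5 + 3 * √3) / 4)) * (ρ ^ 3 - (-5 + 3 * √3) / 4) := by
  have h : √3 ^ 2 = (3 : ℝ) := Real.sq_sqrt (by norm_num)
  linear_combination (9 / 16) * h

/-- If no coordinate vanishes, the squares solve a circulant linear system whose determinant is the
quantity in `h2`. If one vanishes, a triangular system in the other two remains, controlled by `h0`
and `h1`. -/
lemma eq_zero_of_common_zero {K : Type*} [Field K] [CharZero K] {r : K} (h0 : r ≠ 0)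
    (h1 : r ^ 3 + 1 / 2 ≠ 0) (h2 : (r ^ 3) ^ 2 + 5 / 2 * r ^ 3 - 1 / 8 ≠ 0) {x y z : K}
    (hx : x * (r ^ 2 * x ^ 2 + r * y ^ 2 + -(1 / 2) * z ^ 2) = 0)
    (hy : y * (r ^ 2 * y ^ 2 + r * z ^ 2 + -(1 / 2) * x ^ 2) = 0)
    (hz : z * (r ^ 2 * z ^ 2 + r * x ^ 2 + -(1 / 2) * y ^ 2) = 0) : x = 0 ∧ y = 0 ∧ z = 0 := by
  have key1 : ∀ {u v : K}, u * (r ^ 2 * u ^ 2 + r * v ^ 2) = 0 →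
      v * (r ^ 2 * v ^ 2 + -(1 / 2) * u ^ 2) = 0 → u = 0 ∧ v = 0 := by
    intro u v hu hv
    rcases mul_eq_zero.1 hu with hu | hu
    · subst hu
      simpa [h0] using hv
    rcases mul_eq_zero.1 hv with hv | hv
    · subst hv
      simpa [h0] using hu
    have : (r ^ 3 + 1 / 2) * v ^ 2 = 0 := by
      have : r * ((r ^ 3 + 1 / 2) * v ^ 2) = 0 := by
        linear_combination r ^ 2 * hv + (1 / 2) * hu
      simpa [h0] using this
    have hv0 : v = 0 := pow_eq_zero_iff two_ne_zero |>.1 ((mul_eq_zero.1 this).resolve_left h1)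
    subst hv0
    simpa [h0] using hu
  by_cases hx0 : x = 0
  · subst hx0
    have := key1 (u := y) (v := z) (by linear_combination hy) (by linear_combination hz)
    exact ⟨rfl, this⟩
  by_cases hy0 : y = 0
  · subst hy0
    have := key1 (u := z) (v := x) (by linear_combination hz) (by linear_combination hx)
    exact ⟨this.2, rfl, this.1⟩
  by_cases hz0 : z = 0
  · subst hz0
    have := key1 (u := x) (v := y) (by linear_combination hx) (by linear_combination hy)
    exact ⟨this.1, this.2, rfl⟩
  exfalso
  have ex := (mul_eq_zero.1 hx).resolve_left hx0
  have ey := (mul_eq_zero.1 hy).resolve_left hy0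
  have ez := (mul_eq_zero.1 hz).resolve_left hz0
  have : ((r ^ 3) ^ 2 + 5 / 2 * r ^ 3 - 1 / 8) * x ^ 2 = 0 := by
    -- The coefficients are cofactors of the circulant matrix.
    linear_combination (r ^ 4 + r / 2) * ex + (1 / 4 - r ^ 3) * ey + (r ^ 2 + r ^ 2 / 2) * ez
  exact mul_ne_zero h2 (pow_ne_zero 2 hx0) this

lemma isPD_sextic {ρ : ℝ} (h0 : ρ ≠ 0) (h1 : ρ ^ 3 + 1 / 2 ≠ 0)
    (h2 : (ρ ^ 3) ^ 2 + 5 / 2 * ρ ^ 3 - 1 / 8 ≠ 0) : IsPD (sextic ρ) := by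
  intro x hx
  have hnn : ∀ i, 0 ≤ (eval x (toForm (cubicVec ρ i))) ^ 2 := fun i => sq_nonneg _
  rw [sextic_eq_sum, map_sum]
  simp only [map_pow]
  refine (Finset.sum_nonneg fun i _ => hnn i).lt_of_ne fun h => hx ?_
  have hz := (Finset.sum_eq_zero_iff_of_nonneg fun i _ => hnn i).1 h.symm
  simp only [Finset.mem_univ, forall_const, sq_eq_zero_iff, cubicVec, toForm_blockVec] at hz
  have e0 := hz 0
  have e1 := hz 1
  have e2 := hz 2
  simp only [map_mul, map_add, map_pow, eval_X, eval_C, Fin.reduceAdd, Fin.isValue] at e0 e1 e2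
  obtain ⟨a, b, c⟩ := eq_zero_of_common_zero h0 h1 h2 e0 e1 e2
  ext i
  fin_cases i <;> simp [a, b, c]

lemma isCoercive_sextic {ρ : ℝ} (h0 : ρ ≠ 0) (h1 : ρ ^ 3 + 1 / 2 ≠ 0)
    (h2 : (ρ ^ 3) ^ 2 + 5 / 2 * ρ ^ 3 - 1 / 8 ≠ 0) : IsCoercive (sextic ρ) := by
  refine ⟨3, fun i => toForm (cubicVec ρ i), sextic_eq_sum ρ, ?_⟩
  rintro ⟨x, hx, hz⟩
  apply hx
  have e0 := hz 0
  have e1 := hz 1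
  have e2 := hz 2
  simp only [cubicVec, toForm_blockVec, map_mul, map_add, map_pow, aeval_X, aeval_C,
    Fin.reduceAdd, Fin.isValue, Complex.coe_algebraMap, Complex.ofReal_neg, Complex.ofReal_div,
    Complex.ofReal_one, Complex.ofReal_ofNat] at e0 e1 e2
  have h1' : (ρ : ℂ) ^ 3 + 1 / 2 ≠ 0 := fun h => h1 <| Complex.ofReal_eq_zero.1 (by
    push_cast
    exact h)
  have h2' : ((ρ : ℂ) ^ 3) ^ 2 + 5 / 2 * (ρ : ℂ) ^ 3 - 1 / 8 ≠ 0 :=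
    fun h => h2 <| Complex.ofReal_eq_zero.1 (by
      push_cast
      exact h)
  obtain ⟨a, b, c⟩ := eq_zero_of_common_zero (r := (ρ : ℂ)) (by exact_mod_cast h0) h1' h2' e0 e1 e2
  ext i
  fin_cases i <;> simp [a, b, c]

lemma eval_sextic (ρ x y z : ℝ) : eval ![x, y, z] (sextic ρ) =
    x ^ 2 * (ρ ^ 2 * x ^ 2 + ρ * y ^ 2 - 1 / 2 * z ^ 2) ^ 2
    + y ^ 2 * (ρ ^ 2 * y ^ 2 + ρ * z ^ 2 - 1 / 2 * x ^ 2) ^ 2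
    + z ^ 2 * (ρ ^ 2 * z ^ 2 + ρ * x ^ 2 - 1 / 2 * y ^ 2) ^ 2 := by
  simp [sextic]

/-- Each excluded value produces an explicit real zero: `(1, 0, 0)`, `(0, 1, √(-ρ))` or `(1, 1, 1)`.
-/
lemma ne_of_isPD_sextic {ρ : ℝ} (h : IsPD (sextic ρ)) :
    ρ ≠ 0 ∧ ρ ^ 3 + 1 / 2 ≠ 0 ∧ (ρ ^ 3) ^ 2 + 5 / 2 * ρ ^ 3 - 1 / 8 ≠ 0 := by
  refine ⟨?_, ?_, ?_⟩
  · rintro rfl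
    have := h ![1, 0, 0] (by simp)
    rw [eval_sextic] at this
    norm_num at this
  · intro h1
    have hρ : ρ < 0 := by
      by_contra hc
      have : 0 ≤ ρ ^ 3 := pow_nonneg (not_lt.1 hc) 3
      linarith
    have hs : √(-ρ) ^ 2 = -ρ := Real.sq_sqrt (by linarith)
    have := h ![0, 1, √(-ρ)] (by simp)
    rw [eval_sextic, hs] at this
    have e : ρ ^ 2 * -ρ + ρ * 0 ^ 2 - 1 / 2 * 1 ^ 2 = 0 := by linear_combination -h1
    rw [e] at this
    ring_nf at this
    exact lt_irrefl _ this
  · intro h2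
    have hs : ρ ^ 2 + ρ - 1 / 2 = 0 := by
      -- The factorization of `u³ + v³ + w³ - 3uvw` at `(u, v, w) = (ρ², ρ, -1/2)`.
      have hf : (ρ ^ 2 + ρ - 1 / 2) *
          ((ρ ^ 2 - ρ) ^ 2 + (ρ + 1 / 2) ^ 2 + (ρ ^ 2 + 1 / 2) ^ 2) = 0 := by
        linear_combination 2 * h2
      exact (mul_eq_zero.1 hf).resolve_right (by positivity)
    have := h ![1, 1, 1] (by simp)
    rw [eval_sextic] at this
    have e : ρ ^ 2 * 1 ^ 2 + ρ * 1 ^ 2 - 1 / 2 * 1 ^ 2 = 0 := by linear_combination hs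
    rw [e] at this
    norm_num at this

/-! ### Positive definite Gram matrices -/

/-- Four equations in three unknowns, obtained by comparing coefficients in `g = ∑ pᵢ hᵢ` for cyclic
`hᵢ`. The only compatibility condition is `hL`, which says `L g = 0` after division by `3ρ²`. -/
lemma exists_multiplier {ρ B C E : ℝ} (h0 : ρ ≠ 0) (h1 : ρ ^ 3 + 1 / 2 ≠ 0)
    (hL : (1 / 8 - 2 * ρ ^ 3) / ρ ^ 2 + 3 / 2 * ρ ^ 2 * B + (1 / 4 - ρ ^ 3) * C
      + (ρ ^ 4 + ρ / 2) * (E / 3) = 0) :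
    ∃ α β γ : ℝ, ρ ^ 2 * α = 1 ∧ ρ * α + ρ ^ 2 * β - γ / 2 = B ∧
      -(α / 2) + ρ * β + ρ ^ 2 * γ = C ∧ 3 * (ρ * γ - β / 2) = E := by
  have hd : ρ ^ 4 + ρ / 2 ≠ 0 := by
    have : ρ ^ 4 + ρ / 2 = ρ * (ρ ^ 3 + 1 / 2) := by ring
    rw [this]
    exact mul_ne_zero h0 h1
  obtain ⟨α, hα⟩ : ∃ α : ℝ, ρ ^ 2 * α = 1 := ⟨1 / ρ ^ 2, by field_simp⟩
  have hα' : (1 / 8 - 2 * ρ ^ 3) / ρ ^ 2 = (1 / 8 - 2 * ρ ^ 3) * α := by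
    rw [div_eq_iff (by positivity)]
    linear_combination (-(1 / 8 - 2 * ρ ^ 3)) * hα
  -- Cramer's rule for the second and third equations, with determinant `ρ⁴ + ρ/2`.
  obtain ⟨β, hβ⟩ : ∃ β : ℝ, (ρ ^ 4 + ρ / 2) * β = ρ ^ 2 * (B - ρ * α) + (C + α / 2) / 2 :=
    ⟨_, mul_div_cancel₀ _ hd⟩
  obtain ⟨γ, hγ⟩ : ∃ γ : ℝ, (ρ ^ 4 + ρ / 2) * γ = ρ ^ 2 * (C + α / 2) - ρ * (B - ρ * α) :=
    ⟨_, mul_div_cancel₀ _ hd⟩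
  have hB : ρ * α + ρ ^ 2 * β - γ / 2 = B := by
    apply mul_left_cancel₀ hd
    linear_combination ρ ^ 2 * hβ - 1 / 2 * hγ
  have hC : -(α / 2) + ρ * β + ρ ^ 2 * γ = C := by
    apply mul_left_cancel₀ hd
    linear_combination ρ * hβ + ρ ^ 2 * hγ
  refine ⟨α, β, γ, hα, hB, hC, ?_⟩
  apply mul_left_cancel₀ hd
  rw [hα'] at hL
  linear_combination (-3) * hL - 3 * (3 / 2 * ρ ^ 2) * hB
    - 3 * (1 / 4 - ρ ^ 3) * hC

lemma exists_posDef_sextic {ρ B C E : ℝ} (h0 : ρ ≠ 0) (h1 : ρ ^ 3 + 1 / 2 ≠ 0)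
    (hL : (1 / 8 - 2 * ρ ^ 3) / ρ ^ 2 + 3 / 2 * ρ ^ 2 * B + (1 / 4 - ρ ^ 3) * C
      + (ρ ^ 4 + ρ / 2) * (E / 3) = 0)
    {S : Matrix (MultiIndex 3 3) (MultiIndex 3 3) ℝ} (hS : S.PosSemidef)
    (hg : ∀ x : Fin 3 → ℝ, eval x (formOf (1 + S)) = x 0 ^ 6 + x 1 ^ 6 + x 2 ^ 6
      + B * (x 0 ^ 4 * x 1 ^ 2 + x 1 ^ 4 * x 2 ^ 2 + x 2 ^ 4 * x 0 ^ 2)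
      + C * (x 0 ^ 4 * x 2 ^ 2 + x 1 ^ 4 * x 0 ^ 2 + x 2 ^ 4 * x 1 ^ 2)
      + E * (x 0 ^ 2 * x 1 ^ 2 * x 2 ^ 2)) :
    ∃ G : Matrix (MultiIndex 3 3) (MultiIndex 3 3) ℝ, G.PosDef ∧ sextic ρ = formOf G := by
  obtain ⟨α, β, γ, rA, rB, rC, rE⟩ := exists_multiplier h0 h1 hL
  rw [sextic_eq_sum]
  refine exists_posDef_formOf (cubicVec ρ) (fun i => blockVec i α β γ) hS ?_
  refine MvPolynomial.funext fun x => ?_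
  rw [hg x]
  simp only [cubicVec, toForm_blockVec, Fin.sum_univ_three, map_mul, map_add, map_pow, eval_X,
    eval_C, Fin.reduceAdd, Fin.isValue]
  subst rB rC rE
  linear_combination (-(x 0 ^ 6 + x 1 ^ 6 + x 2 ^ 6)) * rA

lemma exists_nonneg_combination (l : ℝ) {p q : ℝ} (hp : 0 < p) (hq : q < 0) :
    ∃ r s : ℝ, 0 ≤ r ∧ 0 ≤ s ∧ l + r * p + s * q = 0 := by
  rcases le_total 0 l with hl | hl
  · exact ⟨0, -l / q, le_rfl, div_nonneg_of_nonpos (by linarith) hq.le,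
      by rw [div_mul_cancel₀ _ hq.ne]; ring⟩
  · exact ⟨-l / p, 0, div_nonneg (by linarith) hp.le, le_rfl, by
      rw [div_mul_cancel₀ _ hp.ne']; ring⟩

lemma toForm_single_cubicIndex_one : toForm (Pi.single (cubicIndex 1 1 1 rfl) 1) =
    (X 0 * X 1 * X 2 : MvPolynomial (Fin 3) ℝ) := by
  rw [toForm_single]
  simp [mono, cubicIndex, Fin.prod_univ_three]

lemma eval_formOf_one (x : Fin 3 → ℝ) :
    eval x (formOf (1 : Matrix (MultiIndex 3 3) (MultiIndex 3 3) ℝ)) =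
      x 0 ^ 6 + x 1 ^ 6 + x 2 ^ 6
      + (x 0 ^ 4 * x 1 ^ 2 + x 1 ^ 4 * x 2 ^ 2 + x 2 ^ 4 * x 0 ^ 2)
      + (x 0 ^ 4 * x 2 ^ 2 + x 1 ^ 4 * x 0 ^ 2 + x 2 ^ 4 * x 1 ^ 2)
      + x 0 ^ 2 * x 1 ^ 2 * x 2 ^ 2 := by
  rw [formOf_one, sum_multiIndex_three_three]
  simp [cubicIndex, mono, Fin.prod_univ_three]
  ring

/-- Here `d < 0`, so `L` is negative on `(xyz)²` and positive on the squares `(xᵢ xᵢ₊₂²)²`; one of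
the two corrects `L` of the starting form to zero. -/
lemma exists_posDef_of_neg {ρ : ℝ} (hρ : ρ < 0) (h1 : 0 < ρ ^ 3 + 1 / 2) :
    ∃ G : Matrix (MultiIndex 3 3) (MultiIndex 3 3) ℝ, G.PosDef ∧ sextic ρ = formOf G := by
  have hd : ρ ^ 4 + ρ / 2 < 0 := by
    have : ρ ^ 4 + ρ / 2 = ρ * (ρ ^ 3 + 1 / 2) := by ring
    rw [this]
    exact mul_neg_of_neg_of_pos hρ h1
  obtain ⟨r, s, hr, hs, h⟩ := exists_nonneg_combination
    ((1 / 8 - 2 * ρ ^ 3) / ρ ^ 2 + 3 / 2 * ρ ^ 2 + (1 / 4 - ρ ^ 3) + (ρ ^ 4 + ρ / 2) / 3)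
    (p := 3 / 2 * ρ ^ 2) (by have := hρ.ne; positivity) hd
  refine exists_posDef_sextic hρ.ne h1.ne' (B := 1 + r) (C := 1) (E := 1 + 3 * s)
    (by linear_combination h)
    (S := r • ∑ i, vecMulVec (blockVec i 0 0 1) (blockVec i 0 0 1) + (3 * s) •
      vecMulVec (Pi.single (cubicIndex 1 1 1 rfl) 1) (Pi.single (cubicIndex 1 1 1 rfl) 1))
    (((posSemidef_sum_vecMulVec _).smul hr).add
      ((posSemidef_vecMulVec_real _).smul (by positivity))) fun x => ?_
  rw [formOf_add, formOf_add, formOf_smul, formOf_smul, formOf_sum_vecMulVec, formOf_vecMulVec,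
    toForm_single_cubicIndex_one, map_add, eval_formOf_one]
  simp only [toForm_blockVec, Fin.sum_univ_three, map_mul, map_add, map_pow, eval_X,
    eval_C, Fin.reduceAdd, Fin.isValue]
  ring

/-- Here `bc - d² < 0`, so the `2 × 2` block of `L` on `xᵢ xᵢ₊₁²`, `xᵢ xᵢ₊₂²` is indefinite. The
vector `(b, -d)` has the negative value `b (bc - d²)`. -/
lemma exists_posDef_of_discr_pos {ρ : ℝ} (h0 : ρ ≠ 0) (h1 : ρ ^ 3 + 1 / 2 ≠ 0)
    (h2 : 0 < (ρ ^ 3) ^ 2 + 5 / 2 * ρ ^ 3 - 1 / 8) :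
    ∃ G : Matrix (MultiIndex 3 3) (MultiIndex 3 3) ℝ, G.PosDef ∧ sextic ρ = formOf G := by
  have hb : 0 < 3 / 2 * ρ ^ 2 := by positivity
  have hbd : 3 / 2 * ρ ^ 2 * (1 / 4 - ρ ^ 3) - (ρ ^ 4 + ρ / 2) ^ 2 < 0 := by
    have : 3 / 2 * ρ ^ 2 * (1 / 4 - ρ ^ 3) - (ρ ^ 4 + ρ / 2) ^ 2
        = -(ρ ^ 2 * ((ρ ^ 3) ^ 2 + 5 / 2 * ρ ^ 3 - 1 / 8)) := by ring
    rw [this]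
    exact neg_neg_of_pos (by positivity)
  obtain ⟨r, s, hr, hs, h⟩ := exists_nonneg_combination
    ((1 / 8 - 2 * ρ ^ 3) / ρ ^ 2 + 3 / 2 * ρ ^ 2 + (1 / 4 - ρ ^ 3) + (ρ ^ 4 + ρ / 2) / 3)
    hb (mul_neg_of_pos_of_neg hb hbd)
  set b := 3 / 2 * ρ ^ 2 with hbdef
  set d := ρ ^ 4 + ρ / 2 with hddef
  refine exists_posDef_sextic h0 h1 (B := 1 + r + s * d ^ 2) (C := 1 + s * b ^ 2)
    (E := 1 - 6 * s * b * d) (by rw [← hbdef, ← hddef]; linear_combination h)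
    (S := r • ∑ i, vecMulVec (blockVec i 0 0 1) (blockVec i 0 0 1) +
      s • ∑ i, vecMulVec (blockVec i 0 b (-d)) (blockVec i 0 b (-d)))
    (((posSemidef_sum_vecMulVec _).smul hr).add
      ((posSemidef_sum_vecMulVec _).smul hs)) fun x => ?_
  rw [formOf_add, formOf_add, formOf_smul, formOf_smul, formOf_sum_vecMulVec,
    formOf_sum_vecMulVec, map_add, eval_formOf_one]
  simp only [toForm_blockVec, Fin.sum_univ_three, map_mul, map_add, map_pow, eval_X,
    eval_C, Fin.reduceAdd, Fin.isValue]
  ring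

lemma rank_eq_ten_of_posDef {G : Matrix (MultiIndex 3 3) (MultiIndex 3 3) ℝ} (hG : G.PosDef) :
    G.rank = 10 := by
  rw [rank_of_isUnit G hG.isUnit, card_multiIndex_three_three]

lemma inIntervals_iff {ρ : ℝ} : InIntervals ρ ↔
    0 < ρ * (ρ ^ 3 + 1 / 2) ∧ (ρ ^ 3) ^ 2 + 5 / 2 * ρ ^ 3 - 1 / 8 < 0 := by
  have h3 : √3 ^ 2 = (3 : ℝ) := Real.sq_sqrt (by norm_num)
  have h3' : 0 ≤ √3 := Real.sqrt_nonneg _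
  have hlow : 5 / 3 < √3 := by nlinarith
  have hpos : 0 < ρ ^ 3 ↔ 0 < ρ := Odd.pow_pos_iff (by decide)
  rw [circulant_factor, InIntervals]
  constructor
  · rintro (⟨ha, hb⟩ | ⟨ha, hb⟩)
    · have hρ : ρ < 0 := by
        by_contra hc
        have : 0 ≤ ρ ^ 3 := pow_nonneg (not_lt.1 hc) 3
        linarith
      exact ⟨mul_pos_of_neg_of_neg hρ (by linarith),
        mul_neg_of_pos_of_neg (by linarith) (by linarith)⟩
    · exact ⟨mul_pos (hpos.1 ha) (by linarith),
        mul_neg_of_pos_of_neg (by linarith) (by linarith)⟩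
  · rintro ⟨ha, hb⟩
    have hb' : -((5 + 3 * √3) / 4) < ρ ^ 3 ∧ ρ ^ 3 < (-5 + 3 * √3) / 4 := by
      rcases mul_neg_iff.1 hb with h | h
      · exact ⟨by linarith, by linarith⟩
      · linarith
    rcases mul_pos_iff.1 ha with h | h
    · exact Or.inr ⟨hpos.2 h.1, hb'.2⟩
    · exact Or.inl ⟨hb'.1, by linarith⟩

lemma exists_posDef_of_isPD {ρ : ℝ} (h : IsPD (sextic ρ)) (hI : ¬ InIntervals ρ) :
    ∃ G : Matrix (MultiIndex 3 3) (MultiIndex 3 3) ℝ, G.PosDef ∧ sextic ρ = formOf G := by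
  obtain ⟨h0, h1, h2⟩ := ne_of_isPD_sextic h
  rw [inIntervals_iff, not_and_or, not_lt, not_lt] at hI
  rcases hI with hI | hI
  · rcases lt_or_gt_of_ne h0 with hρ | hρ
    · refine exists_posDef_of_neg hρ (lt_of_le_of_ne ?_ h1.symm)
      by_contra hc
      nlinarith
    · have : 0 < ρ ^ 3 := by positivity
      nlinarith
  · exact exists_posDef_of_discr_pos h0 h1 (lt_of_le_of_ne hI h2.symm)

/-! ### Uniqueness of the Gram matrix -/

/-- The values of a functional on the monomials of degree six that vanishes on the monomials with
an odd exponent and is invariant under cyclic permutation of the variables. -/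
def momentCoeff (a b c d : ℝ) : ℕ → ℕ → ℕ → ℝ
  | 6, 0, 0 => a
  | 0, 6, 0 => a
  | 0, 0, 6 => a
  | 4, 2, 0 => b
  | 0, 4, 2 => b
  | 2, 0, 4 => b
  | 4, 0, 2 => c
  | 2, 4, 0 => c
  | 0, 2, 4 => c
  | 2, 2, 2 => d
  | _, _, _ => 0

/-- The linear functional on polynomials with values `momentCoeff a b c d` on the monomials. -/
noncomputable def moment (a b c d : ℝ) : MvPolynomial (Fin 3) ℝ →ₗ[ℝ] ℝ :=
  (basisMonomials (Fin 3) ℝ).constr ℝ fun s => momentCoeff a b c d (s 0) (s 1) (s 2)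

lemma mono_mul_mono_eq_monomial {n p : ℕ} (α β : MultiIndex n p) :
    mono α * mono β = monomial (Finsupp.equivFunOnFinite.symm (α.1 + β.1)) 1 := by
  rw [monomial_eq, Finsupp.prod_fintype _ _ (by simp)]
  simp [mono, pow_add, Finset.prod_mul_distrib]

lemma moment_mono_mul_mono (a b c d : ℝ) (α β : MultiIndex 3 3) :
    moment a b c d (mono α * mono β) =
      momentCoeff a b c d (α.1 0 + β.1 0) (α.1 1 + β.1 1) (α.1 2 + β.1 2) := by
  have := (basisMonomials (Fin 3) ℝ).constr_basis ℝ
    (fun s => momentCoeff a b c d (s 0) (s 1) (s 2)) (Finsupp.equivFunOnFinite.symm (α.1 + β.1))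
  rw [coe_basisMonomials] at this
  rw [mono_mul_mono_eq_monomial, moment, this]
  simp

lemma moment_sq (a b c d : ℝ) (v : MultiIndex 3 3 → ℝ) :
    moment a b c d (toForm v ^ 2) = ∑ α, ∑ β, v α * v β *
      momentCoeff a b c d (α.1 0 + β.1 0) (α.1 1 + β.1 1) (α.1 2 + β.1 2) := by
  rw [sq, ← formOf_vecMulVec]
  simp only [formOf, map_sum, ← smul_eq_C_mul, map_smul, moment_mono_mul_mono, vecMulVec_apply,
    smul_eq_mul]

/-- The quadratic form of `moment a b c d` on the span of `x³`, `xy²`, `xz²`. -/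
def blockForm (a b c d u v w : ℝ) : ℝ :=
  a * u ^ 2 + c * v ^ 2 + b * w ^ 2 + 2 * b * u * v + 2 * c * u * w + 2 * d * v * w

lemma moment_sq_eq (a b c d : ℝ) (v : MultiIndex 3 3 → ℝ) :
    moment a b c d (toForm v ^ 2) =
      blockForm a b c d (v (cubicIndex 3 0 0 rfl)) (v (cubicIndex 1 2 0 rfl))
        (v (cubicIndex 1 0 2 rfl)) +
      blockForm a b c d (v (cubicIndex 0 3 0 rfl)) (v (cubicIndex 0 1 2 rfl))
        (v (cubicIndex 2 1 0 rfl)) +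
      blockForm a b c d (v (cubicIndex 0 0 3 rfl)) (v (cubicIndex 2 0 1 rfl))
        (v (cubicIndex 0 2 1 rfl)) + d * v (cubicIndex 1 1 1 rfl) ^ 2 := by
  rw [moment_sq]
  generalize e1 : v (cubicIndex 3 0 0 rfl) = v1
  generalize e2 : v (cubicIndex 0 3 0 rfl) = v2
  generalize e3 : v (cubicIndex 0 0 3 rfl) = v3
  generalize e4 : v (cubicIndex 1 2 0 rfl) = v4
  generalize e5 : v (cubicIndex 0 1 2 rfl) = v5
  generalize e6 : v (cubicIndex 2 0 1 rfl) = v6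
  generalize e7 : v (cubicIndex 1 0 2 rfl) = v7
  generalize e8 : v (cubicIndex 2 1 0 rfl) = v8
  generalize e9 : v (cubicIndex 0 2 1 rfl) = v9
  generalize e10 : v (cubicIndex 1 1 1 rfl) = v10
  simp only [sum_multiIndex_three_three, e1, e2, e3, e4, e5, e6, e7, e8, e9, e10]
  simp only [cubicIndex, cons_val_zero, cons_val_one, cons_val, Nat.reduceAdd, momentCoeff,
    Fin.isValue, mul_zero, add_zero, zero_add, blockForm]
  ring

section Block

variable {r a b c d : ℝ}

/-- The hypotheses say that `(r², r, -1/2)` is in the kernel of the block. Subtracting `k` times it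
removes the first coordinate, and a square is completed in the other two. -/
lemma blockForm_eq (h1 : r ^ 2 * a + r * b - c / 2 = 0) (h2 : r ^ 2 * b + r * c - d / 2 = 0)
    (h3 : r ^ 2 * c + r * d - b / 2 = 0) (k v w : ℝ) :
    b * blockForm a b c d (k * r ^ 2) v w =
      (b * (w + k / 2) + d * (v - k * r)) ^ 2 + (b * c - d ^ 2) * (v - k * r) ^ 2 := by
  unfold blockForm
  linear_combination (k ^ 2 * r ^ 2 * b) * h1 + (2 * k * v * b - k ^ 2 * r * b) * h2 +
    (2 * k * w * b + k ^ 2 * b / 2) * h3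

lemma blockForm_nonneg (hr : r ≠ 0) (h1 : r ^ 2 * a + r * b - c / 2 = 0)
    (h2 : r ^ 2 * b + r * c - d / 2 = 0) (h3 : r ^ 2 * c + r * d - b / 2 = 0) (hb : 0 < b)
    (hbc : 0 < b * c - d ^ 2) (u v w : ℝ) : 0 ≤ blockForm a b c d u v w := by
  have h := blockForm_eq h1 h2 h3 (u / r ^ 2) v w
  rw [div_mul_cancel₀ _ (pow_ne_zero 2 hr)] at h
  refine nonneg_of_mul_nonneg_right (a := b) ?_ hb
  rw [h]
  positivity

lemma eq_of_blockForm_eq_zero (hr : r ≠ 0) (h1 : r ^ 2 * a + r * b - c / 2 = 0)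
    (h2 : r ^ 2 * b + r * c - d / 2 = 0) (h3 : r ^ 2 * c + r * d - b / 2 = 0) (hb : 0 < b)
    (hbc : 0 < b * c - d ^ 2) {u v w : ℝ} (h0 : blockForm a b c d u v w = 0) :
    v = u / r ^ 2 * r ∧ w = u / r ^ 2 * -(1 / 2) := by
  have h := blockForm_eq h1 h2 h3 (u / r ^ 2) v w
  rw [div_mul_cancel₀ _ (pow_ne_zero 2 hr), h0, mul_zero] at h
  generalize u / r ^ 2 = k at h ⊢
  have hv : (b * c - d ^ 2) * (v - k * r) ^ 2 = 0 :=
    le_antisymm (by nlinarith [sq_nonneg (b * (w + k / 2) + d * (v - k * r))]) (by positivity)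
  have hv' : v - k * r = 0 := by simpa [hbc.ne'] using hv
  rw [hv'] at h
  have hw : w + k / 2 = 0 := by simpa [hb.ne'] using h.symm
  exact ⟨by linarith, by linarith⟩

end Block

lemma moment_sq_nonneg {r a b c d : ℝ} (hr : r ≠ 0) (h1 : r ^ 2 * a + r * b - c / 2 = 0)
    (h2 : r ^ 2 * b + r * c - d / 2 = 0) (h3 : r ^ 2 * c + r * d - b / 2 = 0) (hb : 0 < b)
    (hd : 0 < d) (hbc : 0 < b * c - d ^ 2) (v : MultiIndex 3 3 → ℝ) :
    0 ≤ moment a b c d (toForm v ^ 2) := by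
  rw [moment_sq_eq]
  have := blockForm_nonneg hr h1 h2 h3 hb hbc
  have hv := mul_nonneg hd.le (sq_nonneg (v (cubicIndex 1 1 1 rfl)))
  exact add_nonneg (add_nonneg (add_nonneg (this _ _ _) (this _ _ _)) (this _ _ _)) hv

lemma moment_sextic {r a b c d : ℝ} (h1 : r ^ 2 * a + r * b - c / 2 = 0)
    (h2 : r ^ 2 * b + r * c - d / 2 = 0) (h3 : r ^ 2 * c + r * d - b / 2 = 0) :
    moment a b c d (sextic r) = 0 := by
  have hz : blockForm a b c d (r ^ 2) r (-(1 / 2)) = 0 := by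
    unfold blockForm
    linear_combination r ^ 2 * h1 + r * h2 - 1 / 2 * h3
  have hzero : blockForm a b c d 0 0 0 = 0 := by simp [blockForm]
  rw [sextic_eq_sum, map_sum]
  refine Finset.sum_eq_zero fun i _ => ?_
  rw [moment_sq_eq]
  fin_cases i <;> simp [cubicVec, blockVec, cubicIndex, hzero] <;> simpa using hz

lemma mem_span_of_moment_sq_eq_zero {r a b c d : ℝ} (hr : r ≠ 0)
    (h1 : r ^ 2 * a + r * b - c / 2 = 0)
    (h2 : r ^ 2 * b + r * c - d / 2 = 0) (h3 : r ^ 2 * c + r * d - b / 2 = 0) (hb : 0 < b)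
    (hd : 0 < d) (hbc : 0 < b * c - d ^ 2) {v : MultiIndex 3 3 → ℝ}
    (h : moment a b c d (toForm v ^ 2) = 0) :
    ∃ k : Fin 3 → ℝ, v = ∑ i, k i • cubicVec r i := by
  rw [moment_sq_eq] at h
  have n1 := blockForm_nonneg hr h1 h2 h3 hb hbc (v (cubicIndex 3 0 0 rfl))
    (v (cubicIndex 1 2 0 rfl)) (v (cubicIndex 1 0 2 rfl))
  have n2 := blockForm_nonneg hr h1 h2 h3 hb hbc (v (cubicIndex 0 3 0 rfl))
    (v (cubicIndex 0 1 2 rfl)) (v (cubicIndex 2 1 0 rfl))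
  have n3 := blockForm_nonneg hr h1 h2 h3 hb hbc (v (cubicIndex 0 0 3 rfl))
    (v (cubicIndex 2 0 1 rfl)) (v (cubicIndex 0 2 1 rfl))
  have n4 : 0 ≤ d * v (cubicIndex 1 1 1 rfl) ^ 2 := by positivity
  obtain ⟨a1, a2⟩ := eq_of_blockForm_eq_zero hr h1 h2 h3 hb hbc
    (le_antisymm (by linarith) n1)
  obtain ⟨b1, b2⟩ := eq_of_blockForm_eq_zero hr h1 h2 h3 hb hbc
    (le_antisymm (by linarith) n2)
  obtain ⟨c1, c2⟩ := eq_of_blockForm_eq_zero hr h1 h2 h3 hb hbc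
    (le_antisymm (by linarith) n3)
  have d1 : v (cubicIndex 1 1 1 rfl) = 0 := by
    have : d * v (cubicIndex 1 1 1 rfl) ^ 2 = 0 := le_antisymm (by linarith) n4
    simpa [hd.ne'] using this
  refine ⟨![v (cubicIndex 3 0 0 rfl) / r ^ 2, v (cubicIndex 0 3 0 rfl) / r ^ 2,
    v (cubicIndex 0 0 3 rfl) / r ^ 2], funext ?_⟩
  rw [forall_multiIndex_three_three]
  refine ⟨?_, ?_, ?_, a1.trans ?_, b1.trans ?_, c1.trans ?_, a2.trans ?_, b2.trans ?_,
    c2.trans ?_, d1.trans ?_⟩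
  all_goals
    simp only [Fin.sum_univ_three, Pi.add_apply, Pi.smul_apply, cubicVec, blockVec]
    simp [cubicIndex, hr]

/-- The products of the three cubics are linearly independent. -/
lemma eq_one_of_sum_mul_eq {r : ℝ} (hr : r ≠ 0) {A : Matrix (Fin 3) (Fin 3) ℝ} (hA : Aᵀ = A)
    (h : ∑ i, ∑ j, C (A i j) * (toForm (cubicVec r i) * toForm (cubicVec r j)) = sextic r) :
    A = 1 := by
  have key : ∀ x y z : ℝ, eval ![x, y, z] (∑ i, ∑ j, C (A i j) *
      (toForm (cubicVec r i) * toForm (cubicVec r j))) = eval ![x, y, z] (sextic r) :=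
    fun x y z => by rw [h]
  simp only [eval_sextic, cubicVec, toForm_blockVec, Fin.sum_univ_three, map_mul, map_add, map_pow,
    eval_X, eval_C, Fin.reduceAdd, Fin.isValue, cons_val_zero, cons_val_one, cons_val] at key
  have s01 : A 1 0 = A 0 1 := congrFun (congrFun hA 0) 1
  have s02 : A 2 0 = A 0 2 := congrFun (congrFun hA 0) 2
  have s12 : A 2 1 = A 1 2 := congrFun (congrFun hA 1) 2
  rw [s01, s02, s12] at key
  have d0 : A 0 0 = 1 := mul_left_cancel₀ (pow_ne_zero 4 hr) (by linear_combination key 1 0 0)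
  have d1 : A 1 1 = 1 := mul_left_cancel₀ (pow_ne_zero 4 hr) (by linear_combination key 0 1 0)
  have d2 : A 2 2 = 1 := mul_left_cancel₀ (pow_ne_zero 4 hr) (by linear_combination key 0 0 1)
  -- Chosen so that the product of the first two cubics is nonzero at `(1, t, 0)`. Passing to `-t`
  -- flips only the sign of that product, so the difference isolates an off-diagonal entry.
  obtain ⟨t, ht, ht1, ht2⟩ : ∃ t : ℝ, t ≠ 0 ∧ r + t ^ 2 ≠ 0 ∧ r ^ 2 * t ^ 2 - 1 / 2 ≠ 0 := by
    have hp : 0 < 1 / (2 * r ^ 2) + r ^ 2 + 1 := by positivity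
    refine ⟨√(1 / (2 * r ^ 2) + r ^ 2 + 1), (Real.sqrt_pos.2 hp).ne', ?_, ?_⟩ <;>
      rw [Real.sq_sqrt hp.le]
    · have : 0 < 1 / (2 * r ^ 2) := by positivity
      nlinarith [sq_nonneg (r + 1)]
    · have : r ^ 2 * (1 / (2 * r ^ 2) + r ^ 2 + 1) - 1 / 2 = r ^ 2 * (r ^ 2 + 1) := by
        field_simp
        ring
      rw [this]
      positivity
  have hne : 4 * r * t * (r + t ^ 2) * (r ^ 2 * t ^ 2 - 1 / 2) ≠ 0 := by
    refine mul_ne_zero (mul_ne_zero (by positivity) ht1) ht2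
  have o01 : A 0 1 = 0 := mul_left_cancel₀ hne
    (by linear_combination key 1 t 0 - key 1 (-t) 0)
  have o12 : A 1 2 = 0 := mul_left_cancel₀ hne
    (by linear_combination key 0 1 t - key 0 1 (-t))
  have o02 : A 0 2 = 0 := mul_left_cancel₀ hne
    (by linear_combination key t 0 1 - key (-t) 0 1)
  ext i j
  fin_cases i <;> fin_cases j <;> simp [*]

open scoped ComplexOrder MatrixOrder Matrix.Norms.L2Operator in
lemma exists_eq_sum_vecMulVec {m : Type*} [Fintype m] [DecidableEq m] {G : Matrix m m ℝ}
    (hG : G.PosSemidef) : ∃ B : m → m → ℝ, G = ∑ k, vecMulVec (B k) (B k) := by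
  obtain ⟨B, rfl⟩ := CStarAlgebra.nonneg_iff_eq_star_mul_self.1 hG.nonneg
  refine ⟨B, ?_⟩
  ext α β
  simp [Matrix.sum_apply, vecMulVec_apply, Matrix.mul_apply, star_eq_conjTranspose]

lemma sum_vecMulVec_of_mem_span {m κ ι : Type*} [Fintype κ] [Fintype ι] (k : κ → ι → ℝ)
    (P : ι → m → ℝ) :
    ∑ l, vecMulVec (∑ i, k l i • P i) (∑ i, k l i • P i) =
      ∑ i, ∑ j, ((of k)ᵀ * of k) i j • vecMulVec (P i) (P j) := by
  ext α β
  simp only [Matrix.sum_apply, vecMulVec_apply, Finset.sum_apply, Pi.smul_apply, smul_eq_mul,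
    Finset.sum_mul_sum, Matrix.smul_apply, Matrix.mul_apply, transpose_apply, of_apply]
  simp only [Finset.sum_mul]
  rw [Finset.sum_comm]
  refine Finset.sum_congr rfl fun i _ => ?_
  rw [Finset.sum_comm]
  exact Finset.sum_congr rfl fun j _ => Finset.sum_congr rfl fun l _ => by ring

lemma eq_of_isGramMatrix_sextic {ρ : ℝ} (hI : InIntervals ρ)
    {G : Matrix (MultiIndex 3 3) (MultiIndex 3 3) ℝ} (hG : IsGramMatrix G (sextic ρ)) :
    G = ∑ i, vecMulVec (cubicVec ρ i) (cubicVec ρ i) := by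
  obtain ⟨hd, hbc⟩ := inIntervals_iff.1 hI
  have h0 : ρ ≠ 0 := by
    rintro rfl
    simp at hd
  obtain ⟨a, ha⟩ : ∃ a, a = 1 / 8 - 2 * ρ ^ 3 := ⟨_, rfl⟩
  obtain ⟨b, hb⟩ : ∃ b, b = 3 / 2 * ρ ^ 4 := ⟨_, rfl⟩
  obtain ⟨c, hc⟩ : ∃ c, c = ρ ^ 2 * (1 / 4 - ρ ^ 3) := ⟨_, rfl⟩
  obtain ⟨d, hd'⟩ : ∃ d, d = ρ ^ 2 * (ρ * (ρ ^ 3 + 1 / 2)) := ⟨_, rfl⟩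
  have e1 : ρ ^ 2 * a + ρ * b - c / 2 = 0 := by rw [ha, hb, hc]; ring
  have e2 : ρ ^ 2 * b + ρ * c - d / 2 = 0 := by rw [hb, hc, hd']; ring
  have e3 : ρ ^ 2 * c + ρ * d - b / 2 = 0 := by rw [hb, hc, hd']; ring
  have pb : 0 < b := by rw [hb]; positivity
  have pd : 0 < d := by rw [hd']; positivity
  have pbc : 0 < b * c - d ^ 2 := by
    have : b * c - d ^ 2 = ρ ^ 6 * -((ρ ^ 3) ^ 2 + 5 / 2 * ρ ^ 3 - 1 / 8) := by
      rw [hb, hc, hd']; ring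
    rw [this]
    exact mul_pos (by positivity) (neg_pos.2 hbc)
  obtain ⟨B, rfl⟩ := exists_eq_sum_vecMulVec hG.1
  -- Nonnegative terms with sum `L (sextic ρ) = 0`.
  have hzero : ∀ k, moment a b c d (toForm (B k) ^ 2) = 0 := by
    have := moment_sextic e1 e2 e3
    rw [hG.2, formOf_sum_vecMulVec, map_sum, Finset.sum_eq_zero_iff_of_nonneg
      fun k _ => moment_sq_nonneg h0 e1 e2 e3 pb pd pbc (B k)] at this
    exact fun k => this k (Finset.mem_univ k)
  choose k hk using fun l => mem_span_of_moment_sq_eq_zero h0 e1 e2 e3 pb pd pbc (hzero l)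
  have hsum : ∑ l, vecMulVec (B l) (B l) =
      ∑ i, ∑ j, ((of k)ᵀ * of k) i j • vecMulVec (cubicVec ρ i) (cubicVec ρ j) := by
    rw [← sum_vecMulVec_of_mem_span]
    exact Finset.sum_congr rfl fun l _ => by rw [← hk l]
  have hA : (of k)ᵀ * of k = 1 := by
    refine eq_one_of_sum_mul_eq h0 (by simp [transpose_mul]) ?_
    rw [hG.2, hsum]
    simp only [formOf_sum, formOf_smul, formOf_vecMulVec]
  rw [hsum, hA]
  simp [Matrix.one_apply, ite_smul]

/-! ### The theorem -/

lemma isPD_sextic_of_inIntervals {ρ : ℝ} (hI : InIntervals ρ) : IsPD (sextic ρ) := by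
  obtain ⟨hd, hbc⟩ := inIntervals_iff.1 hI
  exact isPD_sextic (left_ne_zero_of_mul hd.ne') (right_ne_zero_of_mul hd.ne') hbc.ne

end GramForms

theorem mainTheorem6 (ρ : ℝ) :
    ((GramForms.IsPD (GramForms.sextic ρ) ∧
        ∃! G : Matrix (GramForms.MultiIndex 3 3) (GramForms.MultiIndex 3 3) ℝ,
          GramForms.IsGramMatrix G (GramForms.sextic ρ)) ↔ GramForms.InIntervals ρ) ∧
    (GramForms.IsPD (GramForms.sextic ρ) → ¬ GramForms.InIntervals ρ →
        ∃ G : Matrix (GramForms.MultiIndex 3 3) (GramForms.MultiIndex 3 3) ℝ,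
          GramForms.IsGramMatrix G (GramForms.sextic ρ) ∧ G.rank = 10) ∧
    (ρ ^ 3 ≠ -((5 + 3 * √3) / 4) → ρ ^ 3 ≠ -(1 / 2) → ρ ^ 3 ≠ 0 →
        ρ ^ 3 ≠ (-5 + 3 * √3) / 4 → GramForms.IsCoercive (GramForms.sextic ρ)) := by
  open GramForms in
  have rank_ten : IsPD (sextic ρ) → ¬ InIntervals ρ →
      ∃ G : Matrix (MultiIndex 3 3) (MultiIndex 3 3) ℝ,
        IsGramMatrix G (sextic ρ) ∧ G.rank = 10 := fun hPD hI => by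
    obtain ⟨G, hG, hf⟩ := exists_posDef_of_isPD hPD hI
    exact ⟨G, ⟨hG.posSemidef, hf⟩, rank_eq_ten_of_posDef hG⟩
  refine ⟨⟨fun ⟨hPD, hu⟩ => ?_, fun hI =>
    ⟨GramForms.isPD_sextic_of_inIntervals hI, _,
    GramForms.isGramMatrix_sextic ρ, fun G hG => GramForms.eq_of_isGramMatrix_sextic hI hG⟩⟩,
    rank_ten, fun h1 h2 h3 h4 => ?_⟩
  · by_contra hI
    obtain ⟨G, hG, hrank⟩ := rank_ten hPD hI
    have hle := GramForms.rank_sum_vecMulVec_le (GramForms.cubicVec ρ)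
    rw [hu.unique (GramForms.isGramMatrix_sextic ρ) hG, hrank, Fintype.card_fin] at hle
    omega
  · refine GramForms.isCoercive_sextic (fun h => h3 (by simp [h]))
      (fun h => h2 (by linarith)) ?_
    rw [GramForms.circulant_factor]
    exact mul_ne_zero (sub_ne_zero.2 h1) (sub_ne_zero.2 h4)
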